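/- **Theorem (Sketched confidence ellipsoid).** Let $1\le m\le d$, $\lambda>0$, $R\ge 0$, $L,S\in\mathbb{R}$, and let $w^\star\in\mathbb{R}^d$ satisfy $\|w^\star\|\le S$. Consider the linear contextual bandit protocol: in each round $t=1,2,\dots$ a finite decision set $D_t\subset\mathbb{R}^d$ with $\|x\|\le L$ for all $x\in D_t$ is revealed, an arbitrary (possibly randomized) policy selects $x_t\in D_t$ on the basis of the information $\mathcal{F}_{t-1}$ available before round $t$, and the reward $Y_t=x_t^\top w^\star+\eta_t$ is observed. Here $(\mathcal{F}_t)_{t\ge0}$ is a filtration such that $x_t$ is $\mathcal{F}_{t-1}$-measurable, $\eta_t$ is $\mathcal{F}_t$-measurable, and the noise is conditionally $R$-subgaussian: $\mathbb{E}[e^{\theta\eta_t}\mid\mathcal{F}_{t-1}]\le e^{\theta^2R^2/2}$ almost surely for all $t\ge1$, $\theta\in\mathbb{R}$. (For a policy that is a function of the past noise only, $\mathcal{F}_t=\sigma(\eta_1,\dots,\eta_t)$ can be taken.) Let $X_t=[x_1,\dots,x_t]^\top$ and let $S_t\in\mathbb{R}^{m\times d}$ be the Frequent Directions sketch of the actions: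 $S_0=0$, and in round $t$ one takes any eigendecomposition $S_{t-1}^\top S_{t-1}+x_tx_t^\top=U^\top\mathrm{diag}(r_1,\dots,r_m)U$ with $U\in\mathbb{R}^{m\times d}$, $UU^\top=I$, $r_1\ge\dots\ge r_m$, and sets $\rho_t=r_m$ and $S_t=\mathrm{diag}(\sqrt{r_1-\rho_t},\dots,\sqrt{r_{m-1}-\rho_t},0)\,U$. Put $\bar\rho_t=\rho_1+\dots+\rho_t$, $$\widetilde V_t=S_t^\top S_t+\lambda I,\qquad \tilde w_t=\widetilde V_t^{-1}\sum_{s=1}^t x_sY_s ,\qquad \|v\|_{A}=\sqrt{v^\top A v}.$$ Let $\delta\in(0,1)$. Then: 1. For every $t\ge0$, with probability at least $1-\delta$, $w^\star$ belongs to $\widetilde C_t=\{w\in\mathbb{R}^d:\ \|w-\tilde w_t\|_{\widetilde V_t}\le\tilde\beta_t(\delta)\}$, where $$\tilde\beta_t(\delta)=R\sqrt{m\ln\Big(1+\frac{tL^2}{m\lambda}\Big)+2\ln\frac1\delta+d\ln\Big(1+\frac{\bar\rho_t}{\lambda}\Big)}\cdot\sqrt{1+\frac{\bar\rho_t}{\lambda}}+S\sqrt\lambda\Big(1+\frac{\bar\rho_t}{\lambda}\Big).$$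 2. $\tilde\beta_t(\delta)=\widetilde{\mathcal O}\big(R\sqrt{\widetilde m(1+\varepsilon_m)}+S\sqrt\lambda(1+\varepsilon_m)\big)$. Explicitly: for a horizon $T$, let $\lambda_1\ge\dots\ge\lambda_d$ be the eigenvalues of $X_T^\top X_T$, $$\varepsilon_m=\min_{k=0,\dots,m-1}\frac{\lambda_{k+1}+\dots+\lambda_d}{\lambda\,(m-k)},\qquad \widetilde m=m+d\ln(1+\varepsilon_m).$$ Then, for every outcome and all $0\le t\le T$, $$\tilde\beta_t(\delta)\le \sqrt{1+\ln\Big(1+\frac{TL^2}{m\lambda}\Big)+2\ln\frac1\delta}\;\cdot R\sqrt{\widetilde m\,(1+\varepsilon_m)}+S\sqrt\lambda\,(1+\varepsilon_m).$$ -/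

import Mathlib

open MeasureTheory ProbabilityTheory Matrix

noncomputable section

namespace SketchedBandit

/-- Rounds are numbered `1, 2, …`, so entry `0` of a sequence is never read.
`corr x t` is the unregularized correlation matrix `X_tᵀ X_t = ∑_{s=1}^t x_s x_sᵀ`. -/
def corr {d : ℕ} (x : ℕ → EuclideanSpace ℝ (Fin d)) (t : ℕ) : Matrix (Fin d) (Fin d) ℝ :=
  ∑ s ∈ Finset.range t, vecMulVec (x (s + 1)).ofLp (x (s + 1)).ofLp

theorem corr_isHermitian {d : ℕ} (x : ℕ → EuclideanSpace ℝ (Fin d)) (t : ℕ) :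
    (corr x t).IsHermitian := by
  ext i j
  simp [corr, Matrix.sum_apply, vecMulVec_apply, mul_comm]

/-- The norm `‖v‖_A = √(vᵀ A v)` induced by a positive definite matrix `A`. -/
def matNorm {d : ℕ} (A : Matrix (Fin d) (Fin d) ℝ) (v : EuclideanSpace ℝ (Fin d)) : ℝ :=
  Real.sqrt (v.ofLp ⬝ᵥ (A *ᵥ v.ofLp))

/-- One Frequent Directions update. From the sketch `Sk` and the new vector `x`, compute an
eigendecomposition `Uᵀ diag(r₁, …, r_m) U = Skᵀ Sk + x xᵀ`, where the `m` rows of `U` are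
orthonormal and `r₁ ≥ … ≥ r_m`; then `ρ = r_m` and the new sketch is
`Sk' = diag(√(r₁ - ρ), …, √(r_m - ρ)) U`. Every choice of the eigendecomposition is allowed. -/
def IsFDStep {d m : ℕ} (Sk : Matrix (Fin m) (Fin d) ℝ) (x : EuclideanSpace ℝ (Fin d))
    (Sk' : Matrix (Fin m) (Fin d) ℝ) (ρ : ℝ) : Prop :=
  ∃ (U : Matrix (Fin m) (Fin d) ℝ) (r : Fin m → ℝ),
    U * Uᵀ = 1 ∧ Antitone r ∧
    Uᵀ * diagonal r * U = Skᵀ * Sk + vecMulVec x.ofLp x.ofLp ∧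
    IsLeast (Set.range r) ρ ∧
    Sk' = diagonal (fun i => Real.sqrt (r i - ρ)) * U

/-- `Sk 0, Sk 1, …` is a run of Frequent Directions with sketch size `m` on the inputs
`x 1, x 2, …`, started at `Sk 0 = 0`, and `ρ t` is the eigenvalue subtracted in round `t`. -/
structure IsFDSketch {d m : ℕ} (x : ℕ → EuclideanSpace ℝ (Fin d))
    (Sk : ℕ → Matrix (Fin m) (Fin d) ℝ) (ρ : ℕ → ℝ) : Prop where
  init : Sk 0 = 0
  step : ∀ t, IsFDStep (Sk t) (x (t + 1)) (Sk (t + 1)) (ρ (t + 1))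

/-- `ρ̄_t = ρ_1 + ⋯ + ρ_t`. -/
def rhoBar (ρ : ℕ → ℝ) (t : ℕ) : ℝ := ∑ s ∈ Finset.range t, ρ (s + 1)

/-- The sketched regularized correlation matrix `Ṽ = Skᵀ Sk + λ I`. -/
def sketchedV {d m : ℕ} (lam : ℝ) (Sk : Matrix (Fin m) (Fin d) ℝ) :
    Matrix (Fin d) (Fin d) ℝ :=
  Skᵀ * Sk + lam • (1 : Matrix (Fin d) (Fin d) ℝ)

/-- The sketched RLS estimate `w̃_t = Ṽ_t⁻¹ ∑_{s=1}^t Y_s x_s`. -/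
def sketchedRLS {d m : ℕ} (lam : ℝ) (Sk : ℕ → Matrix (Fin m) (Fin d) ℝ)
    (x : ℕ → EuclideanSpace ℝ (Fin d)) (Y : ℕ → ℝ) (t : ℕ) : EuclideanSpace ℝ (Fin d) :=
  WithLp.toLp 2 ((sketchedV lam (Sk t))⁻¹ *ᵥ
    ∑ s ∈ Finset.range t, Y (s + 1) • (x (s + 1)).ofLp)

/-- The radius `β̃_t(δ)`, as a function of the value `rb` of `ρ̄_t`. -/
def betaTilde (d m : ℕ) (R S L lam δ : ℝ) (t : ℕ) (rb : ℝ) : ℝ :=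
  R * Real.sqrt (m * Real.log (1 + t * L ^ 2 / (m * lam)) + 2 * Real.log (1 / δ)
      + d * Real.log (1 + rb / lam)) * Real.sqrt (1 + rb / lam)
    + S * Real.sqrt lam * (1 + rb / lam)

/-- The sketched confidence ellipsoid
`C̃_t = {v | ‖v - w̃_t‖_{Ṽ_t} ≤ β̃_t(δ)}`. -/
def sketchedEllipsoid {d m : ℕ} (R S L lam δ : ℝ) (Sk : ℕ → Matrix (Fin m) (Fin d) ℝ)
    (ρ : ℕ → ℝ) (x : ℕ → EuclideanSpace ℝ (Fin d)) (Y : ℕ → ℝ) (t : ℕ) :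
    Set (EuclideanSpace ℝ (Fin d)) :=
  {v | matNorm (sketchedV lam (Sk t)) (v - sketchedRLS lam Sk x Y t)
        ≤ betaTilde d m R S L lam δ t (rhoBar ρ t)}

/-- The spectral error `ε_m = min_{0 ≤ k < m} (λ_{k+1} + ⋯ + λ_d) / (λ (m - k))`, where
`λ_1 ≥ ⋯ ≥ λ_d` are the eigenvalues of `X_Tᵀ X_T` (here listed with indices from `0`). -/
def spectralError {d : ℕ} (m : ℕ) (lam : ℝ) (x : ℕ → EuclideanSpace ℝ (Fin d)) (T : ℕ) : ℝ :=
  ⨅ k : Fin m,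
    (∑ i ∈ Finset.univ.filter (fun i : Fin (Fintype.card (Fin d)) => k.val ≤ i.val),
      (corr_isHermitian x T).eigenvalues₀ i)
      / (lam * ((m : ℝ) - (k : ℕ)))

/-- The quantity `m̃ = m + d ln(1 + ε)`. -/
def mTilde (d m : ℕ) (ε : ℝ) : ℝ := m + d * Real.log (1 + ε)

/-- `η` is `R`-subgaussian conditionally on the σ-algebra `𝒢`:
`𝔼[exp(θ η) | 𝒢] ≤ exp(θ² R² / 2)` almost surely, for every real `θ`
(integrability is part of the claim, since the conditional expectation has to exist). -/
def CondSubgaussian {Ω : Type*} {mΩ : MeasurableSpace Ω} (P : Measure Ω)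
    (𝒢 : MeasurableSpace Ω) (η : Ω → ℝ) (R : ℝ) : Prop :=
  ∀ θ : ℝ, Integrable (fun ω => Real.exp (θ * η ω)) P ∧
    ∀ᵐ ω ∂P, (P[fun ω' => Real.exp (θ * η ω') | 𝒢]) ω ≤ Real.exp (θ ^ 2 * R ^ 2 / 2)

end SketchedBandit

end

/-! Write `E = XᵀX - SᵀS` for the sketching error, `V = XᵀX + λI`, `z = ∑ η_s x_s`, `c = 1 + ρ̄/λ`.
Each round adds `ρ` times a rank-`m` projection to `E`, so `0 ≤ E ≤ ρ̄ I` and `tr E = m ρ̄`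
(`IsFDSketch.error_bounds`). Everything about the sketch follows from these facts and from `S Sᵀ`
being diagonal.

The estimation error `v = w⋆ - w̃` satisfies `Ṽ v = λ w⋆ - E w⋆ - z`. Pairing with `v` bounds
`‖v‖²_Ṽ` by a bias term, controlled by `E ≤ ρ̄ I` and `λ I ≤ Ṽ`, plus `|v·z| ≤ ‖v‖_V ‖z‖_{V⁻¹}`,
where `V ≤ c Ṽ` costs a factor `√c`. The same comparison bounds `det V` by `c^d det Ṽ`, and `det Ṽ`
has only `m` nontrivial factors.

What remains is the self-normalized bound on `‖z‖_{V⁻¹}` (`measure_selfNormalized_gt_le`): Markov's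
inequality for `exp(‖z‖²_{V⁻¹}/2) / √(det V / λ^d)`, whose expectation never increases. Instead of a
Gaussian mixture on `ℝ^d`, each round uses a one-dimensional mixture with random mean and variance.

For the radius, compute `tr E = m ρ̄` in an eigenbasis of `XᵀX`: the top `k` directions contribute
at most `ρ̄` each, the others at most their eigenvalues, so `(m - k) ρ̄` is at most the spectral
tail. -/

namespace SketchedBandit

/-! ### Quadratic forms, determinants and rank-one updates. -/

section LinearAlgebra

variable {n : Type*} [Fintype n]

theorem quadForm_nonneg {A : Matrix n n ℝ} (hA : A.PosSemidef) (v : n → ℝ) :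
    0 ≤ v ⬝ᵥ (A *ᵥ v) := by
  simpa using hA.dotProduct_mulVec_nonneg v

theorem dotProduct_mulVec_comm {A : Matrix n n ℝ} (hA : A.IsHermitian) (v w : n → ℝ) :
    v ⬝ᵥ (A *ᵥ w) = w ⬝ᵥ (A *ᵥ v) := by
  have hT : Aᵀ = A := by simpa [conjTranspose_eq_transpose_of_trivial] using hA.eq
  rw [dotProduct_mulVec, dotProduct_comm, ← mulVec_transpose, hT]

/-- The Cauchy–Schwarz inequality for the form of a positive semidefinite matrix. -/
theorem abs_dotProduct_mulVec_le [DecidableEq n] {A : Matrix n n ℝ} (hA : A.PosSemidef) (v w : n → ℝ) :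
    |v ⬝ᵥ (A *ᵥ w)| ≤ Real.sqrt (v ⬝ᵥ (A *ᵥ v)) * Real.sqrt (w ⬝ᵥ (A *ᵥ w)) := by
  have h := LinearMap.BilinForm.apply_sq_le_of_symm (Matrix.toBilin' A)
    (fun v => by simpa [Matrix.toBilin'_apply'] using quadForm_nonneg hA v)
    ⟨fun v w => by simpa [Matrix.toBilin'_apply'] using dotProduct_mulVec_comm hA.1 v w⟩ v w
  simp only [Matrix.toBilin'_apply'] at h
  rw [← Real.sqrt_mul (quadForm_nonneg hA v)]
  exact Real.abs_le_sqrt h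

theorem one_le_det_one_add [DecidableEq n] {Q : Matrix n n ℝ} (hQ : Q.PosSemidef) : 1 ≤ (1 + Q).det := by
  have hH : (1 + Q).IsHermitian := (PosSemidef.one.add hQ).1
  rw [hH.det_eq_prod_eigenvalues]
  have : ∏ _i : n, (1 : ℝ) ≤ ∏ i, hH.eigenvalues i := by
    refine Finset.prod_le_prod (fun _ _ => zero_le_one) fun i _ => ?_
    have hn : (hH.eigenvectorBasis i).ofLp ⬝ᵥ (hH.eigenvectorBasis i).ofLp = 1 := by
      have := hH.eigenvectorBasis.norm_eq_one i
      have h2 := real_inner_self_eq_norm_sq (hH.eigenvectorBasis i)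
      rw [this, EuclideanSpace.inner_eq_star_dotProduct] at h2
      simpa using h2
    rw [hH.eigenvalues_eq, add_mulVec, one_mulVec, dotProduct_add]
    simp only [star_trivial, RCLike.re_to_real, hn]
    linarith [quadForm_nonneg hQ (hH.eigenvectorBasis i).ofLp]
  simpa using this

open scoped MatrixOrder in
theorem exists_eq_transpose_mul_self [DecidableEq n] {P : Matrix n n ℝ} (hP : P.PosSemidef) :
    ∃ B : Matrix n n ℝ, P = Bᵀ * B := by
  obtain ⟨B, hB⟩ := CStarAlgebra.nonneg_iff_eq_star_mul_self.mp hP.nonneg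
  exact ⟨B, by simpa [star_eq_conjTranspose, conjTranspose_eq_transpose_of_trivial] using hB⟩

/-- The determinant is monotone in the Loewner order. -/
theorem det_le_det_of_posSemidef_sub [DecidableEq n] {A B : Matrix n n ℝ} (hA : A.PosDef)
    (hAB : (B - A).PosSemidef) : A.det ≤ B.det := by
  obtain ⟨C, hC⟩ := exists_eq_transpose_mul_self hAB
  have hu : IsUnit A.det := (Matrix.isUnit_iff_isUnit_det A).1 hA.isUnit
  -- Swapping the factors inside the determinant turns `A⁻¹CᵀC`, which need not be symmetric, into
  -- the positive semidefinite `CA⁻¹Cᵀ`.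
  have hB : B = A * (1 + (A⁻¹ * Cᵀ) * C) := by
    rw [mul_add, mul_one, ← mul_assoc, ← mul_assoc, mul_nonsing_inv A hu, one_mul, ← hC]
    abel
  rw [hB, det_mul, det_one_add_mul_comm]
  have hQ : (C * (A⁻¹ * Cᵀ)).PosSemidef := by
    have := hA.inv.posSemidef.mul_mul_conjTranspose_same C
    rwa [conjTranspose_eq_transpose_of_trivial, mul_assoc] at this
  exact le_mul_of_one_le_right hA.det_pos.le (one_le_det_one_add hQ)

theorem posSemidef_vecMulVec_self (v : n → ℝ) : (vecMulVec v v).PosSemidef := by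
  simpa using posSemidef_vecMulVec_self_star v

theorem vecMulVec_mulVec_eq_smul (u v w : n → ℝ) : vecMulVec u v *ᵥ w = (v ⬝ᵥ w) • u := by
  rw [vecMulVec_mulVec]; ext i; simp [mul_comm]

theorem det_add_vecMulVec_self [DecidableEq n] {A : Matrix n n ℝ} (hA : IsUnit A.det) (v : n → ℝ) :
    (A + vecMulVec v v).det = A.det * (1 + v ⬝ᵥ (A⁻¹ *ᵥ v)) := by
  rw [vecMulVec_eq Unit, det_add_replicateCol_mul_replicateRow hA]
  congr 1
  rw [det_unique]
  simp only [Matrix.add_apply, Matrix.one_apply_eq]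
  rw [Matrix.mul_assoc, ← replicateCol_mulVec]
  rfl

/-- The effect of a rank-one update of `A` and a shift of `z` along the same direction on the
quadratic form `zᵀ A⁻¹ z`. -/
theorem quadForm_inv_add_vecMulVec [DecidableEq n] {A : Matrix n n ℝ} (hA : A.PosDef) (x z : n → ℝ) (η : ℝ) :
    (z + η • x) ⬝ᵥ ((A + vecMulVec x x)⁻¹ *ᵥ (z + η • x))
      = z ⬝ᵥ (A⁻¹ *ᵥ z)
        + (2 * η * (x ⬝ᵥ (A⁻¹ *ᵥ z)) + η ^ 2 * (x ⬝ᵥ (A⁻¹ *ᵥ x)) - (x ⬝ᵥ (A⁻¹ *ᵥ z)) ^ 2)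
          / (1 + x ⬝ᵥ (A⁻¹ *ᵥ x)) := by
  have hA' : (A + vecMulVec x x).PosDef := hA.add_posSemidef (posSemidef_vecMulVec_self x)
  have hu : IsUnit A.det := (Matrix.isUnit_iff_isUnit_det A).1 hA.isUnit
  have hu' := (Matrix.isUnit_iff_isUnit_det _).1 hA'.isUnit
  have hq := quadForm_nonneg hA.inv.posSemidef x
  have hzx := dotProduct_mulVec_comm hA.inv.1 z x
  have hAb : A *ᵥ (A⁻¹ *ᵥ z) = z := by rw [mulVec_mulVec, mul_nonsing_inv A hu, one_mulVec]
  have hAy : A *ᵥ (A⁻¹ *ᵥ x) = x := by rw [mulVec_mulVec, mul_nonsing_inv A hu, one_mulVec]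
  set b := A⁻¹ *ᵥ z
  set y := A⁻¹ *ᵥ x
  have hne : 1 + x ⬝ᵥ y ≠ 0 := by positivity
  -- Sherman–Morrison, checked by applying `A + xxᵀ` to the right-hand side.
  have key : (A + vecMulVec x x)⁻¹ *ᵥ (z + η • x) = b + ((η - x ⬝ᵥ b) / (1 + x ⬝ᵥ y)) • y := by
    have : z + η • x
        = (A + vecMulVec x x) *ᵥ (b + ((η - x ⬝ᵥ b) / (1 + x ⬝ᵥ y)) • y) := by
      rw [add_mulVec, mulVec_add, mulVec_add, mulVec_smul, mulVec_smul,
        vecMulVec_mulVec_eq_smul, vecMulVec_mulVec_eq_smul, hAb, hAy]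
      ext i
      simp only [Pi.add_apply, Pi.smul_apply, smul_eq_mul]
      field_simp
      ring
    rw [this, mulVec_mulVec, nonsing_inv_mul _ hu', one_mulVec]
  rw [key]
  simp only [dotProduct_add, add_dotProduct, smul_dotProduct, dotProduct_smul, smul_eq_mul, hzx]
  field_simp
  ring

end LinearAlgebra

theorem euclidean_inner_eq_dotProduct {d : ℕ} (v w : EuclideanSpace ℝ (Fin d)) :
    inner ℝ v w = v.ofLp ⬝ᵥ w.ofLp := by
  rw [EuclideanSpace.inner_eq_star_dotProduct, star_trivial, dotProduct_comm]

theorem euclidean_dotProduct_self {d : ℕ} (v : EuclideanSpace ℝ (Fin d)) :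
    v.ofLp ⬝ᵥ v.ofLp = ‖v‖ ^ 2 := by
  rw [← euclidean_inner_eq_dotProduct, real_inner_self_eq_norm_sq]

/-! ### The error of the Frequent Directions sketch. -/

section FrequentDirections

variable {d m : ℕ}

theorem corr_succ (x : ℕ → EuclideanSpace ℝ (Fin d)) (t : ℕ) :
    corr x (t + 1) = corr x t + vecMulVec (x (t + 1)).ofLp (x (t + 1)).ofLp :=
  Finset.sum_range_succ _ _

theorem corr_posSemidef (x : ℕ → EuclideanSpace ℝ (Fin d)) (t : ℕ) : (corr x t).PosSemidef :=
  posSemidef_sum _ fun _ _ => posSemidef_vecMulVec_self _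

theorem rhoBar_succ (ρ : ℕ → ℝ) (t : ℕ) : rhoBar ρ (t + 1) = rhoBar ρ t + ρ (t + 1) :=
  Finset.sum_range_succ _ _

theorem transpose_mul_self_posSemidef (A : Matrix (Fin m) (Fin d) ℝ) : (Aᵀ * A).PosSemidef := by
  simpa [conjTranspose_eq_transpose_of_trivial] using posSemidef_conjTranspose_mul_self A

theorem one_sub_projection_posSemidef {U : Matrix (Fin m) (Fin d) ℝ} (hU : U * Uᵀ = 1) :
    (1 - Uᵀ * U).PosSemidef := by
  have h := posSemidef_conjTranspose_mul_self (1 - Uᵀ * U)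
  have hid : Uᵀ * U * (Uᵀ * U) = Uᵀ * U := by
    rw [Matrix.mul_assoc, ← Matrix.mul_assoc U, hU, Matrix.one_mul]
  have : (1 - Uᵀ * U)ᴴ * (1 - Uᵀ * U) = 1 - Uᵀ * U := by
    simp [conjTranspose_eq_transpose_of_trivial, mul_sub, sub_mul, hid]
  rwa [this] at h

/-- Lowering all `m` eigenvalues by `ρ` removes exactly `ρ UᵀU` from the Gram matrix. Compressing by
`U` shows that `diagonal r` is positive semidefinite, whence `ρ ≥ 0`. The diagonal form of `Sk'
Sk'ᵀ` later gives `det Ṽ`. -/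
theorem IsFDStep.decomposition {Sk Sk' : Matrix (Fin m) (Fin d) ℝ}
    {x : EuclideanSpace ℝ (Fin d)} {ρ : ℝ} (h : IsFDStep Sk x Sk' ρ) :
    0 ≤ ρ ∧ (∃ U : Matrix (Fin m) (Fin d) ℝ, U * Uᵀ = 1 ∧
      Skᵀ * Sk + vecMulVec x.ofLp x.ofLp = Sk'ᵀ * Sk' + ρ • (Uᵀ * U)) ∧
      ∃ g : Fin m → ℝ, 0 ≤ g ∧ Sk' * Sk'ᵀ = diagonal g := by
  obtain ⟨U, r, hU, -, hdec, ⟨⟨i₀, hi₀⟩, hmin⟩, rfl⟩ := h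
  have hle : ∀ i, ρ ≤ r i := fun i => hmin ⟨i, rfl⟩
  have hr : diagonal r = U * (Skᵀ * Sk + vecMulVec x.ofLp x.ofLp) * Uᵀ := by
    rw [← hdec, ← Matrix.mul_assoc, ← Matrix.mul_assoc, hU, Matrix.one_mul, Matrix.mul_assoc, hU, Matrix.mul_one]
  have hpsd : (diagonal r).PosSemidef := by
    rw [hr]
    have := ((transpose_mul_self_posSemidef Sk).add
      (posSemidef_vecMulVec_self x.ofLp)).mul_mul_conjTranspose_same U
    rwa [conjTranspose_eq_transpose_of_trivial] at this
  have hsq : diagonal (fun i => Real.sqrt (r i - ρ)) * diagonal (fun i => Real.sqrt (r i - ρ))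
      = diagonal r - ρ • (1 : Matrix (Fin m) (Fin m) ℝ) := by
    rw [diagonal_mul_diagonal, smul_one_eq_diagonal, diagonal_sub]
    simp only [Real.mul_self_sqrt (sub_nonneg.2 (hle _))]
  refine ⟨?_, ⟨U, hU, ?_⟩, fun i => r i - ρ, fun i => sub_nonneg.2 (hle i), ?_⟩
  · rw [← hi₀]; exact posSemidef_diagonal_iff.1 hpsd i₀
  · rw [← hdec, transpose_mul, diagonal_transpose, Matrix.mul_assoc Uᵀ,
      Matrix.mul_assoc Uᵀ _ (_ * U), ← Matrix.mul_assoc (diagonal _), hsq]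
    simp [Matrix.mul_sub, Matrix.sub_mul]
  · rw [transpose_mul, diagonal_transpose, Matrix.mul_assoc, ← Matrix.mul_assoc U, hU, Matrix.one_mul, hsq,
      smul_one_eq_diagonal, diagonal_sub]

variable {x : ℕ → EuclideanSpace ℝ (Fin d)} {Sk : ℕ → Matrix (Fin m) (Fin d) ℝ} {ρ : ℕ → ℝ}

theorem IsFDSketch.rho_nonneg (h : IsFDSketch x Sk ρ) (t : ℕ) : 0 ≤ ρ (t + 1) :=
  (h.step t).decomposition.1

theorem IsFDSketch.rhoBar_nonneg (h : IsFDSketch x Sk ρ) (t : ℕ) : 0 ≤ rhoBar ρ t :=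
  Finset.sum_nonneg fun s _ => h.rho_nonneg s

theorem IsFDSketch.rhoBar_mono (h : IsFDSketch x Sk ρ) : Monotone (rhoBar ρ) :=
  monotone_nat_of_le_succ fun t => by rw [rhoBar_succ]; linarith [h.rho_nonneg t]

theorem IsFDSketch.exists_gram_eq_diagonal (h : IsFDSketch x Sk ρ) (t : ℕ) :
    ∃ g : Fin m → ℝ, 0 ≤ g ∧ Sk t * (Sk t)ᵀ = diagonal g := by
  cases t with
  | zero => exact ⟨0, le_rfl, by simp [h.init]⟩
  | succ t => exact (h.step t).decomposition.2.2

/-- The error `X_tᵀ X_t - S_tᵀ S_t` of the sketch is positive semidefinite, bounded by `ρ̄_t I`,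
and has trace `m ρ̄_t`. -/
theorem IsFDSketch.error_bounds (h : IsFDSketch x Sk ρ) (t : ℕ) :
    (corr x t - (Sk t)ᵀ * Sk t).PosSemidef ∧
    (rhoBar ρ t • (1 : Matrix (Fin d) (Fin d) ℝ) - (corr x t - (Sk t)ᵀ * Sk t)).PosSemidef ∧
    (corr x t - (Sk t)ᵀ * Sk t).trace = m * rhoBar ρ t := by
  induction t with
  | zero => simp [h.init, corr, rhoBar, PosSemidef.zero]
  | succ t ih =>
    obtain ⟨hρ, ⟨U, hU, hdec⟩, -⟩ := (h.step t).decomposition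
    obtain ⟨h1, h2, h3⟩ := ih
    have hE : corr x (t + 1) - (Sk (t + 1))ᵀ * Sk (t + 1)
        = (corr x t - (Sk t)ᵀ * Sk t) + ρ (t + 1) • (Uᵀ * U) := by
      rw [corr_succ, eq_sub_of_add_eq hdec.symm]
      abel
    rw [hE, rhoBar_succ]
    refine ⟨h1.add ((transpose_mul_self_posSemidef U).smul hρ), ?_, ?_⟩
    · have := h2.add ((one_sub_projection_posSemidef hU).smul hρ)
      convert this using 1
      rw [add_smul, smul_sub]
      abel
    · rw [trace_add, h3, trace_smul, trace_mul_comm, hU, trace_one]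
      simp only [Fintype.card_fin, smul_eq_mul]
      ring

end FrequentDirections

/-! ### Deterministic bounds: log-determinant and ellipsoid membership. -/

section Radius

variable {d m : ℕ}

/-- The regularized correlation matrix `V = X_tᵀ X_t + λ I`. -/
def regCorr {d : ℕ} (lam : ℝ) (x : ℕ → EuclideanSpace ℝ (Fin d)) (t : ℕ) :
    Matrix (Fin d) (Fin d) ℝ :=
  corr x t + lam • (1 : Matrix (Fin d) (Fin d) ℝ)

/-- The noise term `∑_{s=1}^t η_s x_s`. -/
def noiseSum {d : ℕ} (x : ℕ → EuclideanSpace ℝ (Fin d)) (η : ℕ → ℝ) (t : ℕ) : Fin d → ℝ :=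
  ∑ s ∈ Finset.range t, η (s + 1) • (x (s + 1)).ofLp

theorem regCorr_posDef {lam : ℝ} (hlam : 0 < lam) (x : ℕ → EuclideanSpace ℝ (Fin d)) (t : ℕ) :
    (regCorr lam x t).PosDef :=
  (PosDef.one.smul hlam).posSemidef_add (corr_posSemidef x t)

theorem sketchedV_posDef {lam : ℝ} (hlam : 0 < lam) (A : Matrix (Fin m) (Fin d) ℝ) :
    (sketchedV lam A).PosDef :=
  (PosDef.one.smul hlam).posSemidef_add (transpose_mul_self_posSemidef A)

theorem trace_corr_le {L : ℝ} (x : ℕ → EuclideanSpace ℝ (Fin d)) (hx : ∀ s, ‖x (s + 1)‖ ≤ L)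
    (t : ℕ) : (corr x t).trace ≤ t * L ^ 2 := by
  rw [corr, trace_sum]
  refine (Finset.sum_le_sum (g := fun _ => L ^ 2) fun s _ => ?_).trans (by simp)
  rw [trace_vecMulVec, euclidean_dotProduct_self]
  exact pow_le_pow_left₀ (norm_nonneg _) (hx s) 2

/-- Jensen's inequality for `log` with uniform weights. -/
theorem sum_log_one_add_le (hm : 1 ≤ m) {g : Fin m → ℝ} (hg : 0 ≤ g) :
    ∑ i, Real.log (1 + g i) ≤ m * Real.log (1 + (∑ i, g i) / m) := by
  have hm0 : (0 : ℝ) < m := by exact_mod_cast hm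
  have h := strictConcaveOn_log_Ioi.concaveOn.le_map_sum (t := Finset.univ)
    (w := fun _ : Fin m => (m : ℝ)⁻¹) (p := fun i => 1 + g i)
    (fun _ _ => by positivity) (by simp [hm0.ne'])
    (fun i _ => by have := hg i; simp only [Pi.zero_apply] at this; simp; linarith)
  simp only [smul_eq_mul, ← Finset.mul_sum, Finset.sum_add_distrib] at h
  have he : (m : ℝ)⁻¹ * (∑ _i : Fin m, (1 : ℝ) + ∑ i, g i) = 1 + (∑ i, g i) / m := by
    simp; field_simp
  rw [he, inv_mul_le_iff₀ hm0] at h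
  exact h

variable {x : ℕ → EuclideanSpace ℝ (Fin d)} {Sk : ℕ → Matrix (Fin m) (Fin d) ℝ} {ρ : ℕ → ℝ}

/-- The difference equals `(ρ̄/λ) SᵀS + (ρ̄ I - E)`, a sum of positive semidefinite matrices. -/
theorem IsFDSketch.smul_sketchedV_sub_posSemidef (h : IsFDSketch x Sk ρ) {lam : ℝ}
    (hlam : 0 < lam) (t : ℕ) :
    ((1 + rhoBar ρ t / lam) • sketchedV lam (Sk t) - regCorr lam x t).PosSemidef := by
  have h1 := (h.error_bounds t).2.1
  have h2 := (transpose_mul_self_posSemidef (Sk t)).smul (div_nonneg (h.rhoBar_nonneg t) hlam.le)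
  convert h2.add h1 using 1
  ext i j
  simp only [sketchedV, regCorr, Matrix.sub_apply, Matrix.smul_apply, Matrix.add_apply,
    smul_eq_mul]
  field_simp
  ring

theorem IsFDSketch.log_det_regCorr_le (h : IsFDSketch x Sk ρ) (hm : 1 ≤ m) {lam L : ℝ}
    (hlam : 0 < lam) (hx : ∀ s, ‖x (s + 1)‖ ≤ L) (t : ℕ) :
    Real.log ((regCorr lam x t).det / lam ^ d)
      ≤ m * Real.log (1 + t * L ^ 2 / (m * lam)) + d * Real.log (1 + rhoBar ρ t / lam) := by
  have hm0 : (0 : ℝ) < m := by exact_mod_cast hm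
  have hr := h.rhoBar_nonneg t
  have hc : 0 < 1 + rhoBar ρ t / lam := by positivity
  obtain ⟨g, hg, hgram⟩ := h.exists_gram_eq_diagonal t
  have hgi : ∀ i, 0 ≤ g i := hg
  -- Passing to the `m × m` side, where `S Sᵀ` is diagonal, is what puts `m` rather than `d` in
  -- front of the first logarithm.
  have hdet : (sketchedV lam (Sk t)).det = lam ^ d * ∏ i, (1 + g i / lam) := by
    have : sketchedV lam (Sk t) = lam • (1 + (lam⁻¹ • (Sk t)ᵀ) * Sk t) := by
      rw [sketchedV, smul_add, Matrix.smul_mul, smul_smul, mul_inv_cancel₀ hlam.ne', one_smul,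
        add_comm]
    rw [this, det_smul, Fintype.card_fin, det_one_add_mul_comm, Matrix.mul_smul, hgram,
      ← diagonal_one, ← diagonal_smul, diagonal_add, det_diagonal]
    simp [div_eq_inv_mul]
  have hle := det_le_det_of_posSemidef_sub (regCorr_posDef hlam x t)
    (h.smul_sketchedV_sub_posSemidef hlam t)
  rw [det_smul, Fintype.card_fin, hdet] at hle
  have hpos := (regCorr_posDef hlam x t).det_pos
  have hsum : ∑ i, g i ≤ t * L ^ 2 := by
    have h1 : ∑ i, g i = ((Sk t)ᵀ * Sk t).trace := by
      rw [trace_mul_comm, hgram, trace_diagonal]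
    have h2 := (h.error_bounds t).2.2
    rw [trace_sub] at h2
    have h3 := trace_corr_le x hx t
    have : 0 ≤ m * rhoBar ρ t := by positivity
    linarith
  have hfac : ∀ i, 0 < 1 + g i / lam := fun i => by have := hgi i; positivity
  calc Real.log ((regCorr lam x t).det / lam ^ d)
      ≤ Real.log ((1 + rhoBar ρ t / lam) ^ d * ∏ i, (1 + g i / lam)) := by
        refine Real.log_le_log (by positivity) ?_
        rw [div_le_iff₀ (by positivity)]
        linarith
    _ = d * Real.log (1 + rhoBar ρ t / lam) + ∑ i, Real.log (1 + g i / lam) := by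
        rw [Real.log_mul (by positivity) (Finset.prod_pos fun i _ => hfac i).ne', Real.log_pow,
          Real.log_prod (fun i _ => (hfac i).ne')]
    _ ≤ d * Real.log (1 + rhoBar ρ t / lam) + m * Real.log (1 + (∑ i, g i / lam) / m) := by
        gcongr
        exact sum_log_one_add_le hm fun i => div_nonneg (hgi i) hlam.le
    _ ≤ d * Real.log (1 + rhoBar ρ t / lam) + m * Real.log (1 + t * L ^ 2 / (m * lam)) := by
        have h0 : 0 ≤ ∑ i, g i := Finset.sum_nonneg fun i _ => hgi i
        rw [← Finset.sum_div, div_div, mul_comm lam]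
        gcongr
    _ = _ := add_comm _ _

/-- If the self-normalized noise is small, then the true parameter lies in the sketched
ellipsoid. -/
theorem IsFDSketch.mem_sketchedEllipsoid (h : IsFDSketch x Sk ρ) (hm : 1 ≤ m)
    {R S L lam δ : ℝ} (hR : 0 ≤ R) (hlam : 0 < lam) (hx : ∀ s, ‖x (s + 1)‖ ≤ L)
    {w : EuclideanSpace ℝ (Fin d)} (hw : ‖w‖ ≤ S) {η Y : ℕ → ℝ}
    (hY : ∀ s, Y (s + 1) = inner ℝ (x (s + 1)) w + η (s + 1)) (t : ℕ)
    (hz : noiseSum x η t ⬝ᵥ ((regCorr lam x t)⁻¹ *ᵥ noiseSum x η t)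
      ≤ R ^ 2 * (Real.log ((regCorr lam x t).det / lam ^ d) + 2 * Real.log (1 / δ))) :
    w ∈ sketchedEllipsoid R S L lam δ Sk ρ x Y t := by
  have hr := h.rhoBar_nonneg t
  obtain ⟨hE, hE', -⟩ := h.error_bounds t
  have hV := regCorr_posDef hlam x t
  have hVt := sketchedV_posDef hlam (Sk t)
  have hu : IsUnit (regCorr lam x t).det := (Matrix.isUnit_iff_isUnit_det _).1 hV.isUnit
  have hut : IsUnit (sketchedV lam (Sk t)).det := (Matrix.isUnit_iff_isUnit_det _).1 hVt.isUnit
  have hdom := h.smul_sketchedV_sub_posSemidef hlam t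
  have hlog := h.log_det_regCorr_le hm hlam hx t
  have hS : 0 ≤ S := (norm_nonneg w).trans hw
  rw [sketchedEllipsoid, Set.mem_ofPred_eq, matNorm]
  set z := noiseSum x η t
  set E := corr x t - (Sk t)ᵀ * Sk t with hEdef
  set c := 1 + rhoBar ρ t / lam with hcdef
  have hc : 0 < c := by positivity
  set u := w - sketchedRLS lam Sk x Y t with hudef
  set v := u.ofLp with hvdef
  have hsumY : ∑ s ∈ Finset.range t, Y (s + 1) • (x (s + 1)).ofLp = corr x t *ᵥ w.ofLp + z := by
    simp only [corr, z, noiseSum, sum_mulVec, ← Finset.sum_add_distrib]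
    refine Finset.sum_congr rfl fun s _ => ?_
    rw [hY, vecMulVec_mulVec_eq_smul, euclidean_inner_eq_dotProduct, add_smul]
  -- The error equation: `Ṽ w̃ = XᵀX w⋆ + z` and `Ṽ = XᵀX - E + λI`.
  have hVv : sketchedV lam (Sk t) *ᵥ v = lam • w.ofLp - E *ᵥ w.ofLp - z := by
    rw [hvdef, hudef, WithLp.ofLp_sub, mulVec_sub, sketchedRLS, mulVec_mulVec,
      mul_nonsing_inv _ hut, one_mulVec, hsumY, hEdef, sketchedV, add_mulVec, sub_mulVec,
      smul_mulVec, one_mulVec]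
    abel
  set N := Real.sqrt (v ⬝ᵥ (sketchedV lam (Sk t) *ᵥ v)) with hN
  have hN0 : 0 ≤ N := Real.sqrt_nonneg _
  have hNsq : N ^ 2 = v ⬝ᵥ (sketchedV lam (Sk t) *ᵥ v) :=
    Real.sq_sqrt (quadForm_nonneg hVt.posSemidef v)
  have hvv : v ⬝ᵥ v = ‖u‖ ^ 2 := euclidean_dotProduct_self u
  have hvN : ‖u‖ ≤ N / Real.sqrt lam := by
    rw [le_div_iff₀ (Real.sqrt_pos.2 hlam), ← Real.sqrt_sq (norm_nonneg u), ← Real.sqrt_mul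
      (sq_nonneg _), hN]
    refine Real.sqrt_le_sqrt ?_
    have := quadForm_nonneg (transpose_mul_self_posSemidef (Sk t)) v
    rw [sketchedV, add_mulVec, dotProduct_add, smul_mulVec, one_mulVec, dotProduct_smul, hvv,
      smul_eq_mul]
    linarith
  have hEq : ∀ a : EuclideanSpace ℝ (Fin d),
      Real.sqrt (a.ofLp ⬝ᵥ (E *ᵥ a.ofLp)) ≤ Real.sqrt (rhoBar ρ t) * ‖a‖ := by
    intro a
    rw [← Real.sqrt_sq (norm_nonneg a), ← Real.sqrt_mul hr]
    refine Real.sqrt_le_sqrt ?_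
    have := quadForm_nonneg hE' a.ofLp
    rw [sub_mulVec, dotProduct_sub, smul_mulVec, one_mulVec, dotProduct_smul,
      euclidean_dotProduct_self, smul_eq_mul] at this
    linarith
  have h1 : |v ⬝ᵥ (E *ᵥ w.ofLp)| ≤ rhoBar ρ t * (‖u‖ * ‖w‖) := by
    refine (abs_dotProduct_mulVec_le hE v w.ofLp).trans ?_
    calc _ ≤ (Real.sqrt (rhoBar ρ t) * ‖u‖) * (Real.sqrt (rhoBar ρ t) * ‖w‖) :=
          mul_le_mul (hEq u) (hEq w) (Real.sqrt_nonneg _) (by positivity)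
      _ = (Real.sqrt (rhoBar ρ t) * Real.sqrt (rhoBar ρ t)) * (‖u‖ * ‖w‖) := by ring
      _ = _ := by rw [Real.mul_self_sqrt hr]
  have h2 : |v ⬝ᵥ w.ofLp| ≤ ‖u‖ * ‖w‖ := by
    rw [hvdef, ← euclidean_inner_eq_dotProduct]; exact abs_real_inner_le_norm _ _
  have h3 : |v ⬝ᵥ z| ≤ (Real.sqrt c * N) *
      (R * Real.sqrt (m * Real.log (1 + t * L ^ 2 / (m * lam)) + 2 * Real.log (1 / δ)
        + d * Real.log c)) := by
    have hVb : regCorr lam x t *ᵥ ((regCorr lam x t)⁻¹ *ᵥ z) = z := by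
      rw [mulVec_mulVec, mul_nonsing_inv _ hu, one_mulVec]
    have hcs := abs_dotProduct_mulVec_le hV.posSemidef v ((regCorr lam x t)⁻¹ *ᵥ z)
    rw [hVb] at hcs
    refine hcs.trans (mul_le_mul ?_ ?_ (Real.sqrt_nonneg _) (by positivity))
    · rw [hN, ← Real.sqrt_mul hc.le]
      refine Real.sqrt_le_sqrt ?_
      have := quadForm_nonneg hdom v
      rw [sub_mulVec, dotProduct_sub, smul_mulVec, dotProduct_smul, smul_eq_mul] at this
      linarith
    · rw [← Real.sqrt_sq hR, ← Real.sqrt_mul (sq_nonneg _)]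
      refine Real.sqrt_le_sqrt ?_
      rw [dotProduct_comm]
      refine hz.trans (mul_le_mul_of_nonneg_left ?_ (sq_nonneg R))
      linarith
  have hexp : N ^ 2 = lam * (v ⬝ᵥ w.ofLp) - v ⬝ᵥ (E *ᵥ w.ofLp) - v ⬝ᵥ z := by
    rw [hNsq, hVv, dotProduct_sub, dotProduct_sub, dotProduct_smul, smul_eq_mul]
  -- Both bias terms together: `λ + ρ̄ = λ c`, and one `√λ` is spent on `‖u‖ ≤ N/√λ`.
  have huw : (lam + rhoBar ρ t) * (‖u‖ * ‖w‖) ≤ N * (S * Real.sqrt lam * c) := by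
    have hlr : lam + rhoBar ρ t = Real.sqrt lam * Real.sqrt lam * c := by
      rw [Real.mul_self_sqrt hlam.le, hcdef]; field_simp
    have hs := Real.sqrt_pos.2 hlam
    calc (lam + rhoBar ρ t) * (‖u‖ * ‖w‖)
        ≤ (lam + rhoBar ρ t) * (N / Real.sqrt lam * S) := by
          refine mul_le_mul_of_nonneg_left ?_ (by positivity)
          exact mul_le_mul hvN hw (norm_nonneg _) (by positivity)
      _ = _ := by rw [hlr]; field_simp
  have hfin : N * N ≤ N * betaTilde d m R S L lam δ t (rhoBar ρ t) := by
    rw [betaTilde, ← hcdef]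
    have e1 := mul_le_mul_of_nonneg_left (le_of_abs_le h2) hlam.le
    have e2 := neg_le_of_abs_le h1
    have e3 := neg_le_of_abs_le h3
    nlinarith
  -- The factor `N` cancels only if it is nonzero; otherwise the radius just has to be nonnegative.
  rcases hN0.eq_or_lt with h0 | h0
  · rw [← h0, betaTilde, ← hcdef]; positivity
  · exact le_of_mul_le_mul_left hfin h0

end Radius

/-! ### From `ρ̄` to the spectral tail of the actions. -/

section SpectralError

variable {d m : ℕ} {x : ℕ → EuclideanSpace ℝ (Fin d)} {Sk : ℕ → Matrix (Fin m) (Fin d) ℝ}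
  {ρ : ℕ → ℝ}

theorem trace_eq_sum_quadForm {ι : Type*} [Fintype ι] {n : Type*} [Fintype n]
    (A : Matrix n n ℝ) (b : OrthonormalBasis ι ℝ (EuclideanSpace ℝ n)) :
    A.trace = ∑ i, (b i).ofLp ⬝ᵥ (A *ᵥ (b i).ofLp) := by
  classical
  have h := LinearMap.trace_eq_sum_inner (Matrix.toLpLin 2 2 A) b
  have ht : LinearMap.trace ℝ _ (Matrix.toLpLin 2 2 A) = A.trace := by
    rw [Matrix.toLpLin_eq_toLin, LinearMap.trace_eq_matrix_trace ℝ
      (PiLp.basisFun 2 ℝ n), LinearMap.toMatrix_toLin]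
  rw [← ht, h]
  refine Finset.sum_congr rfl fun i _ => ?_
  rw [EuclideanSpace.inner_eq_star_dotProduct, star_trivial, dotProduct_comm]
  rfl

theorem IsFDSketch.rhoBar_le_spectralError (h : IsFDSketch x Sk ρ) (hm : 1 ≤ m)
    {lam : ℝ} (hlam : 0 < lam) (T : ℕ) :
    rhoBar ρ T / lam ≤ spectralError m lam x T := by
  have : Nonempty (Fin m) := ⟨⟨0, hm⟩⟩
  refine le_ciInf fun k => ?_
  have hk : (0 : ℝ) < (m : ℝ) - (k : ℕ) := by
    rw [sub_pos]; exact_mod_cast k.2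
  obtain ⟨-, hE', htr⟩ := h.error_bounds T
  set E := corr x T - (Sk T)ᵀ * Sk T with hEdef
  -- The equivalence by which `eigenvalues` reindexes the sorted `eigenvalues₀`, so `b (e j)`
  -- belongs to the `j`-th largest eigenvalue.
  set e : Fin (Fintype.card (Fin d)) ≃ Fin d := Fintype.equivOfCardEq (Fintype.card_fin _) with he
  set b := (corr_isHermitian x T).eigenvectorBasis
  have hbn : ∀ i, (b i).ofLp ⬝ᵥ (b i).ofLp = 1 := fun i => by
    rw [euclidean_dotProduct_self, b.norm_eq_one, one_pow]
  have hlow : ∀ i, (b i).ofLp ⬝ᵥ (E *ᵥ (b i).ofLp) ≤ rhoBar ρ T := fun i => by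
    have := quadForm_nonneg hE' (b i).ofLp
    rw [sub_mulVec, dotProduct_sub, smul_mulVec, one_mulVec, dotProduct_smul, hbn,
      smul_eq_mul] at this
    linarith
  have hhigh : ∀ j, (b (e j)).ofLp ⬝ᵥ (E *ᵥ (b (e j)).ofLp)
      ≤ (corr_isHermitian x T).eigenvalues₀ j := fun j => by
    have h1 := quadForm_nonneg (transpose_mul_self_posSemidef (Sk T)) (b (e j)).ofLp
    have h2 := (corr_isHermitian x T).mulVec_eigenvectorBasis (e j)
    have h3 : (corr_isHermitian x T).eigenvalues (e j)
        = (corr_isHermitian x T).eigenvalues₀ j := by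
      simp [IsHermitian.eigenvalues, he]
    rw [hEdef, sub_mulVec, dotProduct_sub, h2, dotProduct_smul, hbn, smul_eq_mul, h3]
    linarith
  have hsum : m * rhoBar ρ T = ∑ j, (b (e j)).ofLp ⬝ᵥ (E *ᵥ (b (e j)).ofLp) := by
    rw [← htr, trace_eq_sum_quadForm E b]
    exact (e.sum_comp _).symm
  have hcard : (Finset.univ.filter
      (fun i : Fin (Fintype.card (Fin d)) => ¬ k.val ≤ i.val)).card ≤ k.val := by
    rw [← Finset.card_range k.val]
    refine Finset.card_le_card_of_injOn (fun i => i.val) (fun i hi => ?_)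
      (fun i _ j _ hij => Fin.ext hij)
    simpa using hi
  rw [← Finset.sum_filter_add_sum_filter_not _
    (fun i : Fin (Fintype.card (Fin d)) => k.val ≤ i.val)] at hsum
  have hA := Finset.sum_le_sum fun j (_ : j ∈ Finset.univ.filter
    (fun i : Fin (Fintype.card (Fin d)) => k.val ≤ i.val)) => hhigh j
  have hB := Finset.sum_le_sum fun j (_ : j ∈ Finset.univ.filter
    (fun i : Fin (Fintype.card (Fin d)) => ¬ k.val ≤ i.val)) => hlow (e j)
  rw [Finset.sum_const, nsmul_eq_mul] at hB
  have hC := mul_le_mul_of_nonneg_right (Nat.cast_le (α := ℝ).2 hcard) (h.rhoBar_nonneg T)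
  rw [div_le_div_iff₀ hlam (by positivity)]
  nlinarith

/-- With `A`, `B`, `C` the three logarithms at their largest values, `mA + 2B + dC ≤ (1 + A + 2B)(m
+ dC)`, because `m ≥ 1` and all terms are nonnegative. -/
theorem betaTilde_le {R S L lam δ rb ε : ℝ} (hm : 1 ≤ m) (hR : 0 ≤ R) (hS : 0 ≤ S)
    (hlam : 0 < lam) (hδ0 : 0 < δ) (hδ1 : δ < 1) {t T : ℕ} (htT : t ≤ T) (hrb : 0 ≤ rb)
    (hε : rb / lam ≤ ε) :
    betaTilde d m R S L lam δ t rb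
      ≤ Real.sqrt (1 + Real.log (1 + T * L ^ 2 / (m * lam)) + 2 * Real.log (1 / δ))
          * (R * Real.sqrt (mTilde d m ε * (1 + ε))) + S * Real.sqrt lam * (1 + ε) := by
  have hm1 : (1 : ℝ) ≤ m := by exact_mod_cast hm
  have hr0 : 0 ≤ rb / lam := by positivity
  have hε0 : 0 ≤ ε := hr0.trans hε
  have hA : 0 ≤ Real.log (1 + T * L ^ 2 / (m * lam)) :=
    Real.log_nonneg (le_add_of_nonneg_right (by positivity))
  have hB : 0 ≤ Real.log (1 / δ) := Real.log_nonneg (by rw [le_div_iff₀ hδ0]; linarith)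
  have hC : 0 ≤ Real.log (1 + ε) := Real.log_nonneg (by linarith)
  have hAt : Real.log (1 + t * L ^ 2 / (m * lam)) ≤ Real.log (1 + T * L ^ 2 / (m * lam)) := by
    gcongr
  have hCr : Real.log (1 + rb / lam) ≤ Real.log (1 + ε) := by gcongr
  set A := Real.log (1 + T * L ^ 2 / (m * lam))
  set B := Real.log (1 / δ)
  set C := Real.log (1 + ε) with hCdef
  have key : m * Real.log (1 + t * L ^ 2 / (m * lam)) + 2 * B + d * Real.log (1 + rb / lam)
      ≤ (1 + A + 2 * B) * mTilde d m ε := by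
    have e1 : m * Real.log (1 + t * L ^ 2 / (m * lam)) ≤ m * A := by gcongr
    have e2 : d * Real.log (1 + rb / lam) ≤ d * C := by gcongr
    have e3 : 0 ≤ (A + 2 * B) * (d * C) := by positivity
    have e4 : 0 ≤ ((m : ℝ) - 1) * B := mul_nonneg (by linarith) hB
    rw [mTilde, ← hCdef]
    nlinarith
  have hmT : 0 ≤ mTilde d m ε := by rw [mTilde]; positivity
  rw [betaTilde]
  refine add_le_add ?_ (by gcongr)
  rw [Real.sqrt_mul hmT]
  calc _ ≤ R * Real.sqrt ((1 + A + 2 * B) * mTilde d m ε) * Real.sqrt (1 + ε) := by gcongr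
    _ = _ := by rw [Real.sqrt_mul (by positivity)]; ring

end SpectralError

/-! ### Conditional subgaussianity and the one-step Gaussian mixture. -/

section Subgaussian

open scoped ENNReal

theorem CondSubgaussian.const_div {Ω : Type*} {mΩ : MeasurableSpace Ω} {P : Measure Ω}
    {𝒢 : MeasurableSpace Ω} {η : Ω → ℝ} {R : ℝ} (h : CondSubgaussian P 𝒢 η R) (hR : 0 < R) :
    CondSubgaussian P 𝒢 (fun ω => η ω / R) 1 := by
  intro θ
  have h' := h (θ / R)
  have e1 : ∀ ω, θ / R * η ω = θ * (η ω / R) := fun ω => by ring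
  have e2 : (θ / R) ^ 2 * R ^ 2 / 2 = θ ^ 2 * 1 ^ 2 / 2 := by field_simp
  simpa only [e1, e2] using h'

/-- `e^η + e^{-η} - 2` is nonnegative, vanishes only at `η = 0`, and has expectation at most `0`.
This covers `R = 0`, where the noise cannot be rescaled. -/
theorem CondSubgaussian.ae_eq_zero {Ω : Type*} {mΩ : MeasurableSpace Ω} {P : Measure Ω}
    [IsProbabilityMeasure P] {𝒢 : MeasurableSpace Ω} (h𝒢 : 𝒢 ≤ mΩ) {η : Ω → ℝ}
    (h : CondSubgaussian P 𝒢 η 0) : ∀ᵐ ω ∂P, η ω = 0 := by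
  have hint : ∀ θ : ℝ, ∫ ω, Real.exp (θ * η ω) ∂P ≤ 1 := fun θ => by
    rw [← integral_condExp h𝒢]
    refine (integral_mono_ae integrable_condExp (integrable_const (1 : ℝ)) ?_).trans (by simp)
    filter_upwards [(h θ).2] with ω hω
    simpa using hω
  have h0 : 0 ≤ᵐ[P] fun ω => Real.exp (1 * η ω) + Real.exp (-1 * η ω) - 2 :=
    Filter.Eventually.of_forall fun ω => by
      have h1 := Real.add_one_le_exp (1 * η ω)
      have h2 := Real.add_one_le_exp (-1 * η ω)
      simp only [Pi.zero_apply]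
      linarith
  have hi : Integrable (fun ω => Real.exp (1 * η ω) + Real.exp (-1 * η ω) - 2) P :=
    ((h 1).1.add (h (-1)).1).sub (integrable_const 2)
  have hz : ∫ ω, (Real.exp (1 * η ω) + Real.exp (-1 * η ω) - 2) ∂P = 0 := by
    refine le_antisymm ?_ (integral_nonneg_of_ae h0)
    have hadd : Integrable (fun ω => Real.exp (1 * η ω) + Real.exp (-1 * η ω)) P :=
      (h 1).1.add (h (-1)).1
    rw [integral_sub hadd (integrable_const 2), integral_add (h 1).1 (h (-1)).1]
    have := hint 1
    have := hint (-1)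
    simp only [integral_const, probReal_univ, one_smul]
    linarith
  filter_upwards [(integral_eq_zero_iff_of_nonneg_ae h0 hi).1 hz] with ω hω
  by_contra hne
  have h1 := Real.add_one_lt_exp (x := 1 * η ω) (by simpa using hne)
  have h2 := Real.add_one_le_exp (-1 * η ω)
  simp only [Pi.zero_apply] at hω
  linarith

variable {Ω : Type*} {𝒢 mΩ : MeasurableSpace Ω} {P : Measure Ω} [IsProbabilityMeasure P]
  {η : Ω → ℝ}

/-- On `𝒢`, the measure with density `exp(sη - s²/2)` is dominated by `P`. Comparing measures means
that `G` need not be integrable. -/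
theorem CondSubgaussian.lintegral_mul_exp_le (h𝒢 : 𝒢 ≤ mΩ) (h : CondSubgaussian P 𝒢 η 1)
    (hη : Measurable[mΩ] η) (s : ℝ) {G : Ω → ℝ≥0∞} (hG : Measurable[𝒢] G) :
    ∫⁻ ω, G ω * ENNReal.ofReal (Real.exp (s * η ω - s ^ 2 / 2)) ∂P ≤ ∫⁻ ω, G ω ∂P := by
  set f : Ω → ℝ≥0∞ := fun ω => ENNReal.ofReal (Real.exp (s * η ω - s ^ 2 / 2)) with hf
  have hfm : Measurable[mΩ] f := by fun_prop
  have hle : (P.withDensity f).trim h𝒢 ≤ P.trim h𝒢 := by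
    refine Measure.le_iff.2 fun A hA => ?_
    rw [trim_measurableSet_eq h𝒢 hA, trim_measurableSet_eq h𝒢 hA,
      withDensity_apply f (h𝒢 A hA)]
    have hint : Integrable (fun ω => Real.exp (s * η ω - s ^ 2 / 2)) P := by
      simp only [Real.exp_sub]
      exact (h s).1.div_const _
    rw [hf, ← ofReal_integral_eq_lintegral_ofReal hint.restrict
      (Filter.Eventually.of_forall fun ω => (Real.exp_pos _).le)]
    have hA' : ∫ ω in A, Real.exp (s * η ω) ∂P ≤ Real.exp (s ^ 2 / 2) * P.real A := by
      rw [← setIntegral_condExp h𝒢 (h s).1 hA]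
      refine (integral_mono_ae integrable_condExp.restrict
        (integrable_const (Real.exp (s ^ 2 / 2))) (ae_restrict_of_ae ?_)).trans (by simp [mul_comm])
      filter_upwards [(h s).2] with ω hω
      simpa using hω
    simp only [Real.exp_sub]
    rw [integral_div]
    refine ENNReal.ofReal_le_of_le_toReal ?_
    rw [div_le_iff₀ (Real.exp_pos _), mul_comm]
    exact hA'
  calc ∫⁻ ω, G ω * f ω ∂P = ∫⁻ ω, G ω ∂(P.withDensity f) := by
        rw [lintegral_withDensity_eq_lintegral_mul P hfm (hG.mono h𝒢 le_rfl)]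
        simp only [Pi.mul_apply, mul_comm]
    _ = ∫⁻ ω, G ω ∂((P.withDensity f).trim h𝒢) := (lintegral_trim h𝒢 hG).symm
    _ ≤ ∫⁻ ω, G ω ∂(P.trim h𝒢) := lintegral_mono' hle le_rfl
    _ = ∫⁻ ω, G ω ∂P := lintegral_trim h𝒢 hG

/-- The factor by which the self-normalized potential grows when noise `y` arrives, where
`u = xᵀ V⁻¹ z` and `q = xᵀ V⁻¹ x`. -/
noncomputable def growthFactor (u q y : ℝ) : ℝ :=
  Real.exp ((2 * y * u + y ^ 2 * q - u ^ 2) / (1 + q) / 2) / Real.sqrt (1 + q)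

/-- The growth factor is a Gaussian mixture of exponentials (completing the square). -/
theorem lintegral_exp_mul_gaussianPDF (u y : ℝ) {q : ℝ} (hq : 0 < q) :
    ∫⁻ s : ℝ, ENNReal.ofReal (Real.exp (s * y - s ^ 2 / 2)) * gaussianPDF u q.toNNReal s
      = ENNReal.ofReal (growthFactor u q y) := by
  have hv : (q / (1 + q)).toNNReal ≠ 0 := by
    rw [Ne, Real.toNNReal_eq_zero, not_le]; positivity
  -- The Gaussian on the right is the posterior of `s` under the prior `N(u, q)` after a
  -- unit-variance observation `y`.
  have hpt : ∀ s : ℝ, ENNReal.ofReal (Real.exp (s * y - s ^ 2 / 2)) * gaussianPDF u q.toNNReal s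
      = ENNReal.ofReal (growthFactor u q y)
        * gaussianPDF ((u + q * y) / (1 + q)) (q / (1 + q)).toNNReal s := by
    intro s
    have hg : 0 ≤ growthFactor u q y := by rw [growthFactor]; positivity
    rw [gaussianPDF, gaussianPDF, ← ENNReal.ofReal_mul (Real.exp_pos _).le,
      ← ENNReal.ofReal_mul hg]
    congr 1
    simp only [gaussianPDFReal, growthFactor, Real.coe_toNNReal _ hq.le,
      Real.coe_toNNReal _ (show 0 ≤ q / (1 + q) by positivity)]
    have hsq : Real.sqrt (2 * Real.pi * q)
        = Real.sqrt (1 + q) * Real.sqrt (2 * Real.pi * (q / (1 + q))) := by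
      rw [← Real.sqrt_mul (by positivity)]; congr 1; field_simp
    rw [hsq, mul_inv]
    have hexp : Real.exp (s * y - s ^ 2 / 2) * Real.exp (-(s - u) ^ 2 / (2 * q))
        = Real.exp ((2 * y * u + y ^ 2 * q - u ^ 2) / (1 + q) / 2)
          * Real.exp (-(s - (u + q * y) / (1 + q)) ^ 2 / (2 * (q / (1 + q)))) := by
      rw [← Real.exp_add, ← Real.exp_add]
      congr 1
      field_simp
      ring
    rw [div_eq_mul_inv (Real.exp _)]
    linear_combination ((Real.sqrt (1 + q))⁻¹ *
      (Real.sqrt (2 * Real.pi * (q / (1 + q))))⁻¹) * hexp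
  simp only [hpt]
  rw [lintegral_const_mul _ (measurable_gaussianPDF _ _), lintegral_gaussianPDF_eq_one _ hv,
    mul_one]

/-- Tonelli reduces the mixture to `lintegral_mul_exp_le` for each fixed `s`, since the mixing
density is `𝒢`-measurable in `ω`. -/
theorem CondSubgaussian.lintegral_mul_growthFactor_le (h𝒢 : 𝒢 ≤ mΩ)
    (h : CondSubgaussian P 𝒢 η 1) (hη : Measurable[mΩ] η) {G : Ω → ℝ≥0∞} {u q : Ω → ℝ}
    (hG : Measurable[𝒢] G) (hu : Measurable[𝒢] u) (hq : Measurable[𝒢] q) (hq0 : ∀ ω, 0 ≤ q ω)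
    (huq : ∀ ω, q ω = 0 → u ω = 0) :
    ∫⁻ ω, G ω * ENNReal.ofReal (growthFactor (u ω) (q ω) (η ω)) ∂P ≤ ∫⁻ ω, G ω ∂P := by
  have hGm := hG.mono h𝒢 le_rfl
  have hum := hu.mono h𝒢 le_rfl
  have hqm := hq.mono h𝒢 le_rfl
  set A : Set Ω := {ω | q ω = 0} with hA
  have hAm : MeasurableSet[mΩ] A := hqm (measurableSet_singleton 0)
  set φ : Ω → ℝ → ℝ≥0∞ := fun ω s => gaussianPDF (u ω) (q ω).toNNReal s with hφ
  have hφm' : ∀ s, Measurable[𝒢] fun ω => φ ω s := fun s => by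
    simp only [hφ, gaussianPDF, gaussianPDFReal, Real.coe_toNNReal _ (hq0 _)]
    fun_prop
  have hφm : Measurable (Function.uncurry φ) := by
    unfold Function.uncurry
    simp only [hφ, gaussianPDF, gaussianPDFReal, Real.coe_toNNReal _ (hq0 _)]
    fun_prop
  -- Where `q = 0`, `gaussianPDF` is identically zero and the growth factor is `1`; the indicator
  -- restores this mass.
  have hsplit : ∀ ω, G ω * ENNReal.ofReal (growthFactor (u ω) (q ω) (η ω))
      = A.indicator G ω + ∫⁻ s, G ω * φ ω s *
          ENNReal.ofReal (Real.exp (s * η ω - s ^ 2 / 2)) := by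
    intro ω
    by_cases hω : ω ∈ A
    · have hω' : q ω = 0 := hω
      simp [hω, hφ, hω', huq ω hω', growthFactor]
    · have hpos : 0 < q ω := lt_of_le_of_ne (hq0 ω) (Ne.symm hω)
      rw [Set.indicator_of_notMem hω, zero_add, ← lintegral_exp_mul_gaussianPDF _ _ hpos,
        ← lintegral_const_mul _ (by fun_prop)]
      refine lintegral_congr fun s => ?_
      simp only [hφ]
      ring
  have hmass : ∀ ω, A.indicator G ω + ∫⁻ s, G ω * φ ω s ≤ G ω := by
    intro ω
    by_cases hω : ω ∈ A
    · have hω' : q ω = 0 := hω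
      simp [hω, hφ, hω']
    · have hpos : 0 < q ω := lt_of_le_of_ne (hq0 ω) (Ne.symm hω)
      rw [Set.indicator_of_notMem hω, zero_add, lintegral_const_mul _ (by fun_prop),
        lintegral_gaussianPDF_eq_one _ (by simpa using hpos), mul_one]
  simp only [hsplit]
  rw [lintegral_add_left (hGm.indicator hAm), lintegral_lintegral_swap]
  · calc _ ≤ ∫⁻ ω, A.indicator G ω ∂P + ∫⁻ s, ∫⁻ ω, G ω * φ ω s ∂P := by
          refine add_le_add le_rfl (lintegral_mono fun s => ?_)
          exact h.lintegral_mul_exp_le h𝒢 hη s (hG.mul (hφm' s))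
      _ = ∫⁻ ω, A.indicator G ω ∂P + ∫⁻ ω, (∫⁻ s, G ω * φ ω s) ∂P := by
          refine congrArg _ (lintegral_lintegral_swap ?_).symm
          exact ((hGm.comp measurable_fst).mul hφm).aemeasurable
      _ = ∫⁻ ω, (A.indicator G ω + ∫⁻ s, G ω * φ ω s) ∂P :=
          (lintegral_add_left (hGm.indicator hAm) _).symm
      _ ≤ ∫⁻ ω, G ω ∂P := lintegral_mono hmass
  · refine Measurable.aemeasurable ?_
    refine ((hGm.comp measurable_fst).mul hφm).mul ?_
    fun_prop

end Subgaussian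

/-! ### The self-normalized concentration inequality. -/

section SelfNormalized

open scoped ENNReal

variable {d : ℕ}

/-- The self-normalized potential `exp(‖z‖²_{V⁻¹} / 2) / √(det(V) / λᵈ)`. -/
noncomputable def selfNormPotential (lam : ℝ) (x : ℕ → EuclideanSpace ℝ (Fin d)) (η : ℕ → ℝ) (t : ℕ) : ℝ :=
  Real.exp (noiseSum x η t ⬝ᵥ ((regCorr lam x t)⁻¹ *ᵥ noiseSum x η t) / 2)
    / Real.sqrt ((regCorr lam x t).det / lam ^ d)

theorem selfNormPotential_succ {lam : ℝ} (hlam : 0 < lam) (x : ℕ → EuclideanSpace ℝ (Fin d))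
    (η : ℕ → ℝ) (t : ℕ) :
    selfNormPotential lam x η (t + 1) = selfNormPotential lam x η t *
      growthFactor ((x (t + 1)).ofLp ⬝ᵥ ((regCorr lam x t)⁻¹ *ᵥ noiseSum x η t))
        ((x (t + 1)).ofLp ⬝ᵥ ((regCorr lam x t)⁻¹ *ᵥ (x (t + 1)).ofLp)) (η (t + 1)) := by
  have hV := regCorr_posDef hlam x t
  have hV' : regCorr lam x (t + 1)
      = regCorr lam x t + vecMulVec (x (t + 1)).ofLp (x (t + 1)).ofLp := by
    rw [regCorr, corr_succ, regCorr]; abel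
  have hz' : noiseSum x η (t + 1) = noiseSum x η t + η (t + 1) • (x (t + 1)).ofLp :=
    Finset.sum_range_succ _ _
  have hdet := hV.det_pos
  rw [selfNormPotential, selfNormPotential, growthFactor, hV', hz',
    quadForm_inv_add_vecMulVec hV, add_div, Real.exp_add,
    det_add_vecMulVec_self ((Matrix.isUnit_iff_isUnit_det _).1 hV.isUnit),
    mul_div_right_comm (regCorr lam x t).det,
    Real.sqrt_mul (by positivity), mul_div_mul_comm]

variable {Ω : Type*} {mΩ : MeasurableSpace Ω} {x : ℕ → Ω → EuclideanSpace ℝ (Fin d)}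
  {η : ℕ → Ω → ℝ} {ℱ : Filtration ℕ mΩ}

theorem stronglyMeasurable_noiseSum (hx : ∀ t, StronglyMeasurable[ℱ t] (x (t + 1)))
    (hη : ∀ t, StronglyMeasurable[ℱ (t + 1)] (η (t + 1))) (t : ℕ) :
    StronglyMeasurable[ℱ t] fun ω => noiseSum (fun s => x s ω) (fun s => η s ω) t := by
  refine Finset.stronglyMeasurable_fun_sum _ fun s hs => ?_
  have hst : s + 1 ≤ t := Finset.mem_range.1 hs
  exact ((hη s).mono (ℱ.mono hst)).smul
    ((PiLp.continuous_ofLp 2 _).comp_stronglyMeasurable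
      ((hx s).mono (ℱ.mono ((Nat.le_succ s).trans hst))))

theorem stronglyMeasurable_regCorr (hx : ∀ t, StronglyMeasurable[ℱ t] (x (t + 1))) (lam : ℝ)
    (t : ℕ) : StronglyMeasurable[ℱ t] fun ω => regCorr lam (fun s => x s ω) t := by
  refine StronglyMeasurable.add ?_ stronglyMeasurable_const
  refine Finset.stronglyMeasurable_fun_sum _ fun s hs => ?_
  have hst : s + 1 ≤ t := Finset.mem_range.1 hs
  have hc : Continuous fun v : EuclideanSpace ℝ (Fin d) => vecMulVec v.ofLp v.ofLp :=
    (PiLp.continuous_ofLp 2 _).matrix_vecMulVec (PiLp.continuous_ofLp 2 _)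
  exact hc.comp_stronglyMeasurable ((hx s).mono (ℱ.mono ((Nat.le_succ s).trans hst)))

/-- By Cramer's rule only the scalar `(det A)⁻¹` is discontinuous, and scalar inversion is
measurable. -/
theorem stronglyMeasurable_dotProduct_inv_mulVec {𝒢 : MeasurableSpace Ω}
    {A : Ω → Matrix (Fin d) (Fin d) ℝ} {v w : Ω → Fin d → ℝ} (hA : StronglyMeasurable[𝒢] A)
    (hv : StronglyMeasurable[𝒢] v) (hw : StronglyMeasurable[𝒢] w) :
    StronglyMeasurable[𝒢] fun ω => v ω ⬝ᵥ ((A ω)⁻¹ *ᵥ w ω) := by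
  simp only [inv_def, Ring.inverse_eq_inv', smul_mulVec, dotProduct_smul, smul_eq_mul]
  have hdet : StronglyMeasurable[𝒢] fun ω => (A ω).det :=
    continuous_id.matrix_det.comp_stronglyMeasurable hA
  refine hdet.measurable.inv.stronglyMeasurable.mul ?_
  have hc : Continuous fun p : Matrix (Fin d) (Fin d) ℝ × (Fin d → ℝ) × (Fin d → ℝ) =>
      p.2.1 ⬝ᵥ (p.1.adjugate *ᵥ p.2.2) :=
    continuous_snd.fst.dotProduct (continuous_fst.matrix_adjugate.matrix_mulVec continuous_snd.snd)
  exact hc.comp_stronglyMeasurable (hA.prodMk (hv.prodMk hw))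

theorem lintegral_selfNormPotential_le_one {P : Measure Ω} [IsProbabilityMeasure P] {lam : ℝ}
    (hlam : 0 < lam) (hx : ∀ t, StronglyMeasurable[ℱ t] (x (t + 1)))
    (hη : ∀ t, StronglyMeasurable[ℱ (t + 1)] (η (t + 1)))
    (hsub : ∀ t, CondSubgaussian P (ℱ t) (η (t + 1)) 1) (t : ℕ) :
    (Measurable[ℱ t] fun ω => selfNormPotential lam (fun s => x s ω) (fun s => η s ω) t) ∧
    ∫⁻ ω, ENNReal.ofReal (selfNormPotential lam (fun s => x s ω) (fun s => η s ω) t) ∂P ≤ 1 := by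
  have hmeas : ∀ t,
      Measurable[ℱ t] fun ω => selfNormPotential lam (fun s => x s ω) (fun s => η s ω) t := by
    intro t
    have hV := stronglyMeasurable_regCorr (ℱ := ℱ) hx lam t
    have hz := stronglyMeasurable_noiseSum hx hη t
    have hdet : StronglyMeasurable[ℱ t] fun ω => (regCorr lam (fun s => x s ω) t).det :=
      continuous_id.matrix_det.comp_stronglyMeasurable hV
    exact ((stronglyMeasurable_dotProduct_inv_mulVec hV hz hz).measurable.div_const 2).exp.div
      (hdet.measurable.div_const _).sqrt
  refine ⟨hmeas t, ?_⟩
  induction t with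
  | zero => simp [selfNormPotential, noiseSum, regCorr, corr, hlam.ne']
  | succ t ih =>
    refine le_trans ?_ ih
    have hV := stronglyMeasurable_regCorr (ℱ := ℱ) hx lam t
    have hz := stronglyMeasurable_noiseSum hx hη t
    have hx' : StronglyMeasurable[ℱ t] fun ω => (x (t + 1) ω).ofLp :=
      (PiLp.continuous_ofLp 2 _).comp_stronglyMeasurable (hx t)
    have hVinv : ∀ ω, (regCorr lam (fun s => x s ω) t)⁻¹.PosDef :=
      fun ω => (regCorr_posDef hlam _ t).inv
    have hnn : ∀ ω, 0 ≤ selfNormPotential lam (fun s => x s ω) (fun s => η s ω) t :=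
      fun ω => by rw [selfNormPotential]; positivity
    simp only [selfNormPotential_succ hlam, ENNReal.ofReal_mul (hnn _)]
    refine (hsub t).lintegral_mul_growthFactor_le (ℱ.le t)
      ((hη t).mono (ℱ.le (t + 1))).measurable (hmeas t).ennreal_ofReal
      (stronglyMeasurable_dotProduct_inv_mulVec hV hx' hz).measurable
      (stronglyMeasurable_dotProduct_inv_mulVec hV hx' hx').measurable
      (fun ω => quadForm_nonneg (hVinv ω).posSemidef _) fun ω hω => ?_
    -- `V⁻¹` is positive definite, so `q = 0` forces a zero action and hence `u = 0`.
    have hx0 : (x (t + 1) ω).ofLp = 0 := by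
      by_contra hne
      have := (hVinv ω).dotProduct_mulVec_pos hne
      rw [star_trivial] at this
      exact this.ne' hω
    simp only [hx0, zero_dotProduct]

/-- The self-normalized concentration inequality at a fixed time. -/
theorem measure_selfNormalized_gt_le {P : Measure Ω} [IsProbabilityMeasure P] {lam R δ : ℝ}
    (hlam : 0 < lam) (hR : 0 ≤ R) (hδ : 0 < δ)
    (hx : ∀ t, StronglyMeasurable[ℱ t] (x (t + 1)))
    (hη : ∀ t, StronglyMeasurable[ℱ (t + 1)] (η (t + 1)))
    (hsub : ∀ t, CondSubgaussian P (ℱ t) (η (t + 1)) R) (t : ℕ) :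
    P {ω | R ^ 2 * (Real.log ((regCorr lam (fun s => x s ω) t).det / lam ^ d)
          + 2 * Real.log (1 / δ))
        < noiseSum (fun s => x s ω) (fun s => η s ω) t ⬝ᵥ
          ((regCorr lam (fun s => x s ω) t)⁻¹ *ᵥ
            noiseSum (fun s => x s ω) (fun s => η s ω) t)} ≤ ENNReal.ofReal δ := by
  rcases hR.eq_or_lt with rfl | hR
  · have hzero : ∀ᵐ ω ∂P, ∀ s, η (s + 1) ω = 0 :=
      ae_all_iff.2 fun s => (hsub s).ae_eq_zero (ℱ.le s)
    refine le_of_eq_of_le (measure_eq_zero_iff_ae_notMem.2 ?_) zero_le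
    filter_upwards [hzero] with ω hω
    simp [noiseSum, hω]
  · obtain ⟨hm, hle⟩ := lintegral_selfNormPotential_le_one (ℱ := ℱ) (P := P) hlam hx
      (η := fun s ω => η s ω / R)
      (fun t => ((hη t).measurable.div_const R).stronglyMeasurable)
      (fun t => (hsub t).const_div hR) t
    -- Markov's inequality at level `1/δ` for the potential of the noise rescaled to `η / R`.
    have hmk := (mul_meas_ge_le_lintegral (μ := P) ((hm.mono (ℱ.le t) le_rfl).ennreal_ofReal)
      (ENNReal.ofReal (1 / δ))).trans hle
    have hmk' : P {ω | ENNReal.ofReal (1 / δ) ≤ ENNReal.ofReal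
        (selfNormPotential lam (fun s => x s ω) (fun s => η s ω / R) t)} ≤ ENNReal.ofReal δ := by
      have h1 : ENNReal.ofReal δ * ENNReal.ofReal (1 / δ) = 1 := by
        rw [← ENNReal.ofReal_mul hδ.le, mul_one_div_cancel hδ.ne', ENNReal.ofReal_one]
      have h2 := mul_le_mul_right hmk (ENNReal.ofReal δ)
      rwa [← mul_assoc, h1, one_mul, mul_one] at h2
    refine (measure_mono fun ω hω => ?_).trans hmk'
    rw [Set.mem_ofPred_eq] at hω ⊢
    refine ENNReal.ofReal_le_ofReal ?_
    have hz : noiseSum (fun s => x s ω) (fun s => η s ω) t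
        = R • noiseSum (fun s => x s ω) (fun s => η s ω / R) t := by
      simp only [noiseSum, Finset.smul_sum, smul_smul]
      refine Finset.sum_congr rfl fun s _ => ?_
      rw [mul_div_cancel₀ _ hR.ne']
    rw [hz, mulVec_smul, dotProduct_smul, smul_dotProduct, smul_eq_mul, smul_eq_mul, ← mul_assoc,
      ← sq] at hω
    have hω' := lt_of_mul_lt_mul_left hω (sq_nonneg R)
    have hdet : 0 < (regCorr lam (fun s => x s ω) t).det / lam ^ d :=
      div_pos (regCorr_posDef hlam _ t).det_pos (by positivity)
    rw [selfNormPotential, le_div_iff₀ (Real.sqrt_pos.2 hdet),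
      ← Real.exp_log (show 0 < 1 / δ by positivity), ← Real.exp_log (Real.sqrt_pos.2 hdet),
      ← Real.exp_add, Real.exp_le_exp, Real.log_sqrt hdet.le]
    linarith

end SelfNormalized

end SketchedBandit

theorem theorem3 {Ω : Type*} {mΩ : MeasurableSpace Ω} (P : Measure Ω) [IsProbabilityMeasure P]
    -- dimension, sketch size, and the constants of the problem
    (d m : ℕ) (hm : 1 ≤ m) (hmd : m ≤ d)
    (R S L lam : ℝ) (hR : 0 ≤ R) (hlam : 0 < lam)
    (w : EuclideanSpace ℝ (Fin d)) (hw : ‖w‖ ≤ S)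
    -- `ℱ t` is the information (past rewards, contexts and randomization of the policy) that
    -- the policy has when it selects the action of round `t + 1`
    (ℱ : Filtration ℕ mΩ)
    -- finite decision sets, actions selected from them by the policy, noise and rewards
    (D : ℕ → Ω → Finset (EuclideanSpace ℝ (Fin d)))
    (x : ℕ → Ω → EuclideanSpace ℝ (Fin d)) (η Y : ℕ → Ω → ℝ)
    (hD : ∀ t ω, ∀ y ∈ D (t + 1) ω, ‖y‖ ≤ L)
    (hxD : ∀ t ω, x (t + 1) ω ∈ D (t + 1) ω)
    (hx : ∀ t, StronglyMeasurable[ℱ t] (x (t + 1)))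
    (hη : ∀ t, StronglyMeasurable[ℱ (t + 1)] (η (t + 1)))
    (hsub : ∀ t, SketchedBandit.CondSubgaussian P (ℱ t) (η (t + 1)) R)
    (hY : ∀ t ω, Y (t + 1) ω = inner ℝ (x (t + 1) ω) w + η (t + 1) ω)
    -- the Frequent Directions sketch of the selected actions
    (Sk : ℕ → Ω → Matrix (Fin m) (Fin d) ℝ) (ρ : ℕ → Ω → ℝ)
    (hSk : ∀ ω, SketchedBandit.IsFDSketch (fun t => x t ω) (fun t => Sk t ω) (fun t => ρ t ω))
    (δ : ℝ) (hδ0 : 0 < δ) (hδ1 : δ < 1) :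
    -- with probability at least `1 - δ`, the parameter `w` lies in the ellipsoid
    (∀ t : ℕ,
      P {ω | w ∉ SketchedBandit.sketchedEllipsoid R S L lam δ (fun s => Sk s ω)
          (fun s => ρ s ω) (fun s => x s ω) (fun s => Y s ω) t} ≤ ENNReal.ofReal δ) ∧
    -- the bound on the radius, with the logarithmic factor hidden in `Õ` made explicit
    (∀ T t : ℕ, t ≤ T → ∀ ω,
      let ε := SketchedBandit.spectralError m lam (fun s => x s ω) T
      SketchedBandit.betaTilde d m R S L lam δ t (SketchedBandit.rhoBar (fun s => ρ s ω) t)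
        ≤ Real.sqrt (1 + Real.log (1 + T * L ^ 2 / (m * lam)) + 2 * Real.log (1 / δ))
            * (R * Real.sqrt (SketchedBandit.mTilde d m ε * (1 + ε)))
          + S * Real.sqrt lam * (1 + ε)) := by
  have hxL : ∀ s ω, ‖x (s + 1) ω‖ ≤ L := fun s ω => hD s ω _ (hxD s ω)
  refine ⟨fun t => ?_, fun T t htT ω => ?_⟩
  -- The eigendecompositions need not be chosen measurably in `ω`: the failure event is only
  -- compared, as a set, with the concentration event.
  · refine (measure_mono fun ω hω => ?_).trans
      (SketchedBandit.measure_selfNormalized_gt_le (ℱ := ℱ) hlam hR hδ0 hx hη hsub t)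
    by_contra hnot
    exact hω ((hSk ω).mem_sketchedEllipsoid hm hR hlam (fun s => hxL s ω) hw
      (fun s => hY s ω) t (not_lt.1 hnot))
  · refine SketchedBandit.betaTilde_le hm hR ((norm_nonneg w).trans hw) hlam hδ0 hδ1 htT
      ((hSk ω).rhoBar_nonneg t) ?_
    exact (div_le_div_of_nonneg_right ((hSk ω).rhoBar_mono htT) hlam.le).trans
      ((hSk ω).rhoBar_le_spectralError hm hlam T)
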